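/- Let $m\ge 1$ and let $a_1,\dots,a_m,b_1,\dots,b_m\in\mathbb C$ satisfy $\sum_{j=1}^m\Re(a_j+b_j+1)>1$. For $x\in\mathbb R$ put $$f(x)=\prod_{j=1}^m\frac{1}{\Gamma(a_j+1+x)\,\Gamma(b_j+1-x)},\qquad C_0=\prod_{j=1}^m\frac{1}{\Gamma(a_j+1)\,\Gamma(b_j+1)},$$ where $1/\Gamma$ is the entire reciprocal gamma function, and $${}_mH_m\!\left(\begin{matrix}c_1,\dots,c_m\\ d_1,\dots,d_m\end{matrix};z\right)=\sum_{n=-\infty}^{\infty}\frac{(c_1)_n\cdots(c_m)_n}{(d_1)_n\cdots(d_m)_n}\,z^n,$$ where $(c)_n=c(c+1)\cdots(c+n-1)$ and $(c)_{-n}=\dfrac{1}{(c-1)(c-2)\cdots(c-n)}$ for $n\ge 0$ (that is, $(c)_n=\Gamma(c+n)/\Gamma(c)$ for $n\in\mathbb Z$). Suppose that the bilateral series with $c_j=-b_j$, $d_j=a_j+1$ is well defined, for instance that no $a_j$ and no $b_j$ is a negative integer; more generally, $d_j=-k$ with $k\in\mathbb N_0$ is allowed if $c_i=-l$ for some $i$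 and some integer $0\le l\le k$ (the series then terminates to the right before an undefined term is reached), and $c_j=k+1$ with $k\in\mathbb N_0$ is allowed if $d_i=l+1$ for some $i$ and some integer $0\le l\le k$ (termination to the left); the terms beyond the termination are $0$. Then the two integrands below are Lebesgue integrable on $\mathbb R$, the two series converge absolutely, and $$\int_{-\infty}^{\infty} f(x)\,\frac{\sin((m-1)\pi x)}{\sin(\pi x)}\,dx=C_0\;{}_mH_m\!\left(\begin{matrix}-b_1,\dots,-b_m\\ a_1+1,\dots,a_m+1\end{matrix};1\right),$$ $$\int_{-\infty}^{\infty} f(x)\,\frac{\sin(m\pi x)}{\sin(\pi x)}\,dx=C_0\;{}_mH_m\!\left(\begin{matrix}-b_1,\dots,-b_m\\ a_1+1,\dots,a_m+1\end{matrix};-1\right).$$ -/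

import Mathlib

open MeasureTheory

/-- The shifted factorial `(c)_n = Γ(c + n) / Γ(c)` for an integer `n`, in its polynomial form
`(c)_n = c (c + 1) ⋯ (c + n - 1)` and `(c)_{-n} = 1 / ((c - n) ⋯ (c - 1))` for `n ≥ 0`, which also
covers the removable case `c = 0, -1, -2, …`. -/
noncomputable def shiftedFactorial (c : ℂ) : ℤ → ℂ
  | Int.ofNat n => (ascPochhammer ℂ n).eval c
  | Int.negSucc n => ((ascPochhammer ℂ (n + 1)).eval (c - ((n : ℂ) + 1)))⁻¹

/-- The `n`-th term `(c_1)_n ⋯ (c_p)_n / ((d_1)_n ⋯ (d_q)_n) * z ^ n` of the bilateral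
hypergeometric series. -/
noncomputable def bilateralTerm {p q : ℕ} (c : Fin p → ℂ) (d : Fin q → ℂ) (z : ℂ) (n : ℤ) : ℂ :=
  (∏ j, shiftedFactorial (c j) n) / (∏ j, shiftedFactorial (d j) n) * z ^ n

/-- The bilateral hypergeometric series `pHq(c; d; z)`, summed over all integers. -/
noncomputable def bilateralH {p q : ℕ} (c : Fin p → ℂ) (d : Fin q → ℂ) (z : ℂ) : ℂ :=
  ∑' n : ℤ, bilateralTerm c d z n

/-- The bilateral series with parameters `c` and `d` is well defined. This holds in particular when
no `d j` is one of `0, -1, -2, …` and no `c j` is one of `1, 2, 3, …`.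
The value `d j = -k` makes the terms with `n > k` undefined, and is allowed only when some
`c i = -l` with `l ≤ k` has already terminated the series to the right at `n = l`;
the value `c j = k + 1` makes the terms with `n < -k` undefined, and is allowed only when some
`d i = l + 1` with `l ≤ k` has already terminated the series to the left at `n = -l`.
(In `bilateralTerm` the terms beyond a terminating index are `0`.) -/
def BilateralWellDefined {p q : ℕ} (c : Fin p → ℂ) (d : Fin q → ℂ) : Prop :=
  (∀ (j : Fin q) (k : ℕ), d j = -(k : ℂ) → ∃ (i : Fin p) (l : ℕ), l ≤ k ∧ c i = -(l : ℂ)) ∧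
  (∀ (j : Fin p) (k : ℕ), c j = (k : ℂ) + 1 → ∃ (i : Fin q) (l : ℕ), l ≤ k ∧ d i = (l : ℂ) + 1)

/-- The entire function `f(x) = ∏ j, 1 / (Γ(a_j + 1 + x) Γ(b_j + 1 - x))`, restricted to the real
line. (`Complex.Gamma` is `0` at its poles, so that `1 / Γ` takes its right value `0` there.) -/
noncomputable def gammaProduct {m : ℕ} (a b : Fin m → ℂ) (x : ℝ) : ℂ :=
  ∏ j, 1 / (Complex.Gamma (a j + 1 + (x : ℂ)) * Complex.Gamma (b j + 1 - (x : ℂ)))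

/-- The constant `C_0 = 1 / ∏ j, Γ(a_j + 1) Γ(b_j + 1)`. -/
noncomputable def gammaConst {m : ℕ} (a b : Fin m → ℂ) : ℂ :=
  1 / ∏ j, (Complex.Gamma (a j + 1) * Complex.Gamma (b j + 1))

open Filter Topology

/-! The function `f` extends to an entire function `F`. The reflection formula turns each factor
1/(Γ(α+z)Γ(β-z)) into a Gamma quotient times a sine. Hence `F` is of exponential type mπ vertically
and decays like |x|^(-s) horizontally, with s = ∑ Re(a_j+b_j+1) > 1
(`stripBound_gammaProductEntire`). By a Paley–Wiener argument, ∫ F(x) e^{iωx} dx = 0 for |ω| ≥ mπ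
(`StripBound.integral_exp_eq_zero`).

The kernel sin(pπx)/sin(πx) is the sum of the p exponentials with frequencies π(p-1-2k), 0 ≤ k < p.
If m ≤ p+1, all other frequencies congruent to π(p-1) mod 2π have modulus at least mπ and contribute
nothing. The integral is therefore a full Poisson sum, equal to ∑ F(n) (-1)^{n(p+1)}
(`StripBound.integral_mul_sin_div_sin`).

Finally C_0 times the n-th term of the series is f(n) z^n (-1)^{nm}. The signs agree for p = m-1, z
= 1 and for p = m, z = -1. If C_0 = 0, well-definedness forces f(n) = 0 at every integer, so both
sides vanish. -/

/-! ### Gamma quotients on the right half plane -/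

/-- After swapping the arguments, 1 - t ≤ e^{-t} dominates the beta integrand by a Gamma integrand
on (0, ∞). -/
theorem norm_betaIntegral_le {u v : ℂ} (hu : 1 < u.re) (hv : 0 < v.re) :
    ‖Complex.betaIntegral u v‖ ≤ Real.Gamma v.re * (u.re - 1) ^ (-v.re) := by
  have hr : 0 < u.re - 1 := by linarith
  have hint : IntegrableOn (fun t : ℝ => t ^ (v.re - 1) * Real.exp (-((u.re - 1) * t)))
      (Set.Ioi 0) := by
    have h := integrableOn_rpow_mul_exp_neg_mul_rpow (p := 1) (s := v.re - 1) (b := u.re - 1)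
      (by linarith) one_pos hr
    simpa only [Real.rpow_one, neg_mul] using h
  rw [Complex.betaIntegral_symm, Complex.betaIntegral, intervalIntegral.integral_of_le zero_le_one]
  calc _ ≤ ∫ t in Set.Ioc (0 : ℝ) 1, t ^ (v.re - 1) * Real.exp (-((u.re - 1) * t)) := by
        refine norm_integral_le_of_norm_le (hint.mono_set Set.Ioc_subset_Ioi_self) ?_
        refine (ae_restrict_iff' measurableSet_Ioc).2 (Filter.Eventually.of_forall fun t ht => ?_)
        have h1 : (0 : ℝ) ≤ 1 - t := by linarith [ht.2]
        rw [norm_mul, Complex.norm_cpow_eq_rpow_re_of_pos ht.1]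
        have h2 : ‖(1 - (t : ℂ)) ^ (u - 1)‖ ≤ Real.exp (-((u.re - 1) * t)) := by
          have : (1 - (t : ℂ)) = ((1 - t : ℝ) : ℂ) := by push_cast; ring
          rw [this, Complex.norm_cpow_eq_rpow_re_of_nonneg h1 (by simpa using hr.ne')]
          calc (1 - t) ^ (u - 1).re ≤ (Real.exp (-t)) ^ (u - 1).re := by
                refine Real.rpow_le_rpow h1 ?_ (by simpa using hr.le)
                linarith [Real.add_one_le_exp (-t)]
            _ = _ := by
                rw [← Real.exp_mul]; congr 1; simp; ring
        simpa using mul_le_mul_of_nonneg_left h2 (Real.rpow_nonneg ht.1.le (v - 1).re)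
    _ ≤ ∫ t in Set.Ioi (0 : ℝ), t ^ (v.re - 1) * Real.exp (-((u.re - 1) * t)) := by
        refine setIntegral_mono_set hint ?_ Set.Ioc_subset_Ioi_self.eventuallyLE
        refine (ae_restrict_iff' measurableSet_Ioi).2 (Filter.Eventually.of_forall fun t ht => ?_)
        have : (0 : ℝ) < t := ht
        simp only [Pi.zero_apply]
        positivity
    _ = _ := by
        rw [Real.integral_rpow_mul_exp_neg_mul_Ioi hv hr, Real.rpow_neg hr.le, one_div,
          Real.inv_rpow hr.le, mul_comm]

/-- On the right half plane, `Γ(z + c) / Γ(z + d)` grows at most like `(1 + Re z) ^ Re (c - d)`,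
up to a polynomial factor in `Im z`. -/
def GammaRatioBound (c d : ℂ) : Prop :=
  ∃ (R C : ℝ) (N : ℕ), 0 ≤ C ∧ ∀ z : ℂ, 0 ≤ z.re → R ≤ ‖z‖ → Complex.Gamma (z + c) ≠ 0 ∧
    ‖Complex.Gamma (z + c) * (Complex.Gamma (z + d))⁻¹‖
      ≤ C * (1 + |z.im|) ^ N * (1 + z.re) ^ (c.re - d.re)

/-- Here Γ(z+c)/Γ(z+d) = B(z+c, d-c)/Γ(d-c), and Re c ≥ 2 gives Re(z+c) - 1 ≥ 1 + Re z. -/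
theorem GammaRatioBound.of_re_lt {c d : ℂ} (hc : 2 ≤ c.re) (hcd : c.re < d.re) :
    GammaRatioBound c d := by
  have hv : 0 < (d - c).re := by simpa using hcd
  have hv0 : Complex.Gamma (d - c) ≠ 0 := Complex.Gamma_ne_zero_of_re_pos hv
  refine ⟨0, Real.Gamma (d - c).re * ‖(Complex.Gamma (d - c))⁻¹‖, 0, ?_, fun z hz _ => ?_⟩
  · have := Real.Gamma_pos_of_pos hv
    positivity
  have hu : 0 < (z + c).re := by simp; linarith
  have hd : 0 < (z + d).re := by simp; linarith
  refine ⟨Complex.Gamma_ne_zero_of_re_pos hu, ?_⟩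
  have h := Complex.Gamma_mul_Gamma_eq_betaIntegral hu hv
  rw [show z + c + (d - c) = z + d by ring] at h
  have hd0 := Complex.Gamma_ne_zero_of_re_pos hd
  have e : Complex.Gamma (z + c) * (Complex.Gamma (z + d))⁻¹
      = Complex.betaIntegral (z + c) (d - c) * (Complex.Gamma (d - c))⁻¹ := by
    field_simp
    linear_combination h
  rw [e, norm_mul, pow_zero, mul_one, mul_right_comm]
  gcongr
  refine (norm_betaIntegral_le (by simp; linarith) hv).trans ?_
  have : 0 < Real.Gamma (d - c).re := Real.Gamma_pos_of_pos hv
  gcongr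
  rw [show c.re - d.re = -(d - c).re by simp]
  refine Real.rpow_le_rpow_of_nonpos (by linarith) ?_ (by linarith)
  simp
  linarith

theorem GammaRatioBound.of_add_one_right {c d : ℂ} (h : GammaRatioBound c (d + 1)) :
    GammaRatioBound c d := by
  obtain ⟨R, C, N, hC, h⟩ := h
  refine ⟨R, C * (1 + ‖d‖), N + 1, by positivity, fun z hz hR => ?_⟩
  obtain ⟨h0, h1⟩ := h z hz hR
  refine ⟨h0, ?_⟩
  have e : (Complex.Gamma (z + d))⁻¹ = (z + d) * (Complex.Gamma (z + (d + 1)))⁻¹ := by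
    rw [Complex.one_div_Gamma_eq_self_mul_one_div_Gamma_add_one, add_assoc]
  have hx : 0 < 1 + z.re := by linarith
  -- This factor costs one power of 1 + |Im z|; its power of 1 + Re z restores the exponent.
  have hzd : ‖z + d‖ ≤ (1 + ‖d‖) * ((1 + |z.im|) * (1 + z.re)) := by
    have h2 := norm_add_le z d
    have h3 := Complex.norm_le_abs_re_add_abs_im z
    rw [abs_of_nonneg hz] at h3
    have h4 : 1 + |z.im| + z.re ≤ (1 + |z.im|) * (1 + z.re) := by
      nlinarith [mul_nonneg (abs_nonneg z.im) hz]
    have h5 : 1 ≤ (1 + |z.im|) * (1 + z.re) := by linarith [abs_nonneg z.im]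
    nlinarith [norm_nonneg d]
  rw [e, mul_left_comm, norm_mul]
  calc _ ≤ ((1 + ‖d‖) * ((1 + |z.im|) * (1 + z.re))) *
        (C * (1 + |z.im|) ^ N * (1 + z.re) ^ (c.re - (d + 1).re)) := by gcongr
    _ = C * (1 + ‖d‖) * (1 + |z.im|) ^ (N + 1) *
        ((1 + z.re) ^ (c.re - (d + 1).re) * (1 + z.re)) := by ring
    _ = _ := by
        rw [← Real.rpow_add_one hx.ne']
        congr 2
        simp
        ring

theorem GammaRatioBound.of_add_one_left {c d : ℂ} (h : GammaRatioBound (c + 1) d) :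
    GammaRatioBound c d := by
  obtain ⟨R, C, N, hC, h⟩ := h
  -- The radius 2‖c‖ + 1 keeps z + c away from 0 and makes ‖z + c‖ ≥ (1 + Re z)/4.
  refine ⟨max R (2 * ‖c‖ + 1), C * 4, N, by positivity, fun z hz hR => ?_⟩
  obtain ⟨h0, h1⟩ := h z hz ((le_max_left _ _).trans hR)
  have hR' := (le_max_right _ _).trans hR
  have hx : 0 < 1 + z.re := by linarith
  have hzc : (1 + z.re) / 4 ≤ ‖z + c‖ := by
    have h2 := norm_sub_norm_le z (-c)
    rw [norm_neg, sub_neg_eq_add] at h2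
    have h3 := (le_abs_self _).trans (Complex.abs_re_le_norm z)
    linarith [norm_nonneg c]
  have hzc0 : 0 < ‖z + c‖ := lt_of_lt_of_le (by positivity) hzc
  have hne : z + c ≠ 0 := norm_pos_iff.1 hzc0
  have e : Complex.Gamma (z + (c + 1)) = (z + c) * Complex.Gamma (z + c) := by
    rw [← add_assoc, Complex.Gamma_add_one _ hne]
  refine ⟨fun h3 => h0 (by rw [e, h3, mul_zero]), ?_⟩
  rw [e, mul_assoc, norm_mul] at h1
  refine le_of_mul_le_mul_left (h1.trans ?_) hzc0
  calc _ = (1 + z.re) / 4 * (C * 4 * (1 + |z.im|) ^ N * (1 + z.re) ^ (c.re - d.re)) := by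
        rw [show (c + 1).re - d.re = (c.re - d.re) + 1 by simp; ring, Real.rpow_add_one hx.ne']
        ring
    _ ≤ _ := by gcongr

/-- The functional equation of Γ descends from (c + k, d + l), with k and l large enough for the
beta integral to apply. -/
theorem gammaRatioBound (c d : ℂ) : GammaRatioBound c d := by
  have right : ∀ (k : ℕ) {c d : ℂ}, GammaRatioBound c (d + k) → GammaRatioBound c d := by
    intro k
    induction k with
    | zero => intro c d h; simpa using h
    | succ k ih =>
      intro c d h
      refine ih (GammaRatioBound.of_add_one_right ?_)
      simpa [add_assoc] using h
  have left : ∀ (k : ℕ) {c d : ℂ}, GammaRatioBound (c + k) d → GammaRatioBound c d := by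
    intro k
    induction k with
    | zero => intro c d h; simpa using h
    | succ k ih =>
      intro c d h
      refine ih (GammaRatioBound.of_add_one_left ?_)
      simpa [add_assoc] using h
  obtain ⟨k, hk⟩ := exists_nat_ge (2 - c.re)
  obtain ⟨l, hl⟩ := exists_nat_gt (c.re + k - d.re)
  refine left k (right l (GammaRatioBound.of_re_lt ?_ ?_)) <;> simp <;> linarith

/-! ### Exponential type and horizontal decay -/

theorem Complex.norm_sin_le_exp_abs_im (w : ℂ) : ‖Complex.sin w‖ ≤ Real.exp |w.im| := by
  have h1 : ‖Complex.exp (-w * Complex.I)‖ ≤ Real.exp |w.im| := by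
    rw [Complex.norm_exp]
    exact Real.exp_le_exp.2 (by simpa using le_abs_self w.im)
  have h2 : ‖Complex.exp (w * Complex.I)‖ ≤ Real.exp |w.im| := by
    rw [Complex.norm_exp]
    exact Real.exp_le_exp.2 (by simpa using neg_le_abs w.im)
  have h3 := norm_sub_le (Complex.exp (-w * Complex.I)) (Complex.exp (w * Complex.I))
  rw [Complex.sin, norm_div, norm_mul, Complex.norm_I, mul_one, Complex.norm_two]
  linarith

/-- The majorant `(1 + |Im z|) ^ N * exp (A |Im z|) * (1 + |Re z|) ^ (-s)`. -/
noncomputable def stripWeight (N : ℕ) (A s : ℝ) (z : ℂ) : ℝ :=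
  (1 + |z.im|) ^ N * Real.exp (A * |z.im|) * (1 + |z.re|) ^ (-s)

theorem stripWeight_pos (N : ℕ) (A s : ℝ) (z : ℂ) : 0 < stripWeight N A s z := by
  unfold stripWeight
  positivity

theorem stripWeight_neg (N : ℕ) (A s : ℝ) (z : ℂ) :
    stripWeight N A s (-z) = stripWeight N A s z := by
  simp [stripWeight]

theorem continuous_stripWeight (N : ℕ) (A s : ℝ) : Continuous (stripWeight N A s) := by
  unfold stripWeight
  have h : Continuous fun z : ℂ => (1 + |z.re|) ^ (-s) :=
    Continuous.rpow_const (by fun_prop) fun z => Or.inl (by positivity)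
  fun_prop

theorem stripWeight_mono {M N : ℕ} (h : M ≤ N) (A s : ℝ) (z : ℂ) :
    stripWeight M A s z ≤ stripWeight N A s z := by
  unfold stripWeight
  gcongr
  linarith [abs_nonneg z.im]

theorem stripWeight_mul (M N : ℕ) (A B s t : ℝ) (z : ℂ) :
    stripWeight M A s z * stripWeight N B t z = stripWeight (M + N) (A + B) (s + t) z := by
  unfold stripWeight
  rw [pow_add, add_mul, Real.exp_add, neg_add, Real.rpow_add (by positivity)]
  ring

/-- `F` has exponential type `A` in the vertical direction and decays like `|x| ^ (-s)` in the
horizontal one, up to a polynomial factor in the imaginary part. -/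
def StripBound (F : ℂ → ℂ) (A s : ℝ) : Prop :=
  ∃ (C : ℝ) (N : ℕ), 0 ≤ C ∧ ∀ z, ‖F z‖ ≤ C * stripWeight N A s z

theorem StripBound.one : StripBound (fun _ => 1) 0 0 :=
  ⟨1, 0, zero_le_one, fun z => by simp [stripWeight]⟩

theorem StripBound.mul {F G : ℂ → ℂ} {A B s t : ℝ} (hF : StripBound F A s)
    (hG : StripBound G B t) : StripBound (fun z => F z * G z) (A + B) (s + t) := by
  obtain ⟨C, M, hC, hF⟩ := hF
  obtain ⟨D, N, hD, hG⟩ := hG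
  refine ⟨C * D, M + N, by positivity, fun z => ?_⟩
  rw [norm_mul, ← stripWeight_mul]
  have := stripWeight_pos M A s z
  calc _ ≤ (C * stripWeight M A s z) * (D * stripWeight N B t z) := by
        gcongr
        exacts [hF z, hG z]
    _ = _ := by ring

theorem StripBound.prod {ι : Type*} (S : Finset ι) {F : ι → ℂ → ℂ} {A s : ι → ℝ}
    (h : ∀ i ∈ S, StripBound (F i) (A i) (s i)) :
    StripBound (fun z => ∏ i ∈ S, F i z) (∑ i ∈ S, A i) (∑ i ∈ S, s i) := by
  classical
  induction S using Finset.induction_on with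
  | empty => simpa using StripBound.one
  | insert i S hi ih =>
    simp only [Finset.prod_insert hi, Finset.sum_insert hi]
    exact (h i (Finset.mem_insert_self i S)).mul
      (ih fun j hj => h j (Finset.mem_insert_of_mem hj))

theorem StripBound.comp_neg {F : ℂ → ℂ} {A s : ℝ} (h : StripBound F A s) :
    StripBound (fun z => F (-z)) A s := by
  obtain ⟨C, N, hC, h⟩ := h
  exact ⟨C, N, hC, fun z => stripWeight_neg N A s z ▸ h (-z)⟩

/-- Reflection formula, with the factor 1/π dropped. The hypothesis keeps 1 - s off the poles, where
`Complex.Gamma` is 0 and the bound would fail. -/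
theorem norm_inv_Gamma_le {s : ℂ} (hs : Complex.Gamma (1 - s) ≠ 0) :
    ‖(Complex.Gamma s)⁻¹‖ ≤ ‖Complex.Gamma (1 - s)‖ * ‖Complex.sin (Real.pi * s)‖ := by
  have h := Complex.Gamma_mul_Gamma_one_sub s
  by_cases h0 : Complex.Gamma s = 0
  · rw [h0, inv_zero, norm_zero]
    positivity
  have hsin : Complex.sin (Real.pi * s) ≠ 0 := fun h1 => by
    rw [h1, div_zero] at h
    exact (mul_ne_zero h0 hs) h
  have e : (Complex.Gamma s)⁻¹ * Real.pi = Complex.Gamma (1 - s) * Complex.sin (Real.pi * s) := by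
    rw [eq_div_iff hsin] at h
    rw [inv_mul_eq_iff_eq_mul₀ h0, ← mul_assoc]
    exact h.symm
  rw [← norm_mul, ← e, norm_mul, Complex.norm_real, Real.norm_of_nonneg Real.pi_pos.le]
  exact le_mul_of_one_le_right (norm_nonneg _) (by linarith [Real.pi_gt_three])

theorem exists_norm_inv_Gamma_mul_le_of_re_nonneg (α β : ℂ) :
    ∃ (R C : ℝ) (N : ℕ), 0 ≤ C ∧ ∀ z : ℂ, 0 ≤ z.re → R ≤ ‖z‖ →
      ‖(Complex.Gamma (α + z))⁻¹ * (Complex.Gamma (β - z))⁻¹‖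
        ≤ C * stripWeight N Real.pi (α + β - 1).re z := by
  obtain ⟨R, C, N, hC, h⟩ := gammaRatioBound (1 - β) α
  refine ⟨R, C * Real.exp (Real.pi * |β.im|), N, by positivity, fun z hz hR => ?_⟩
  obtain ⟨h0, h1⟩ := h z hz hR
  have e : z + (1 - β) = 1 - (β - z) := by ring
  rw [e] at h0 h1
  have hsin : ‖Complex.sin (Real.pi * (β - z))‖
      ≤ Real.exp (Real.pi * |β.im|) * Real.exp (Real.pi * |z.im|) := by
    refine (Complex.norm_sin_le_exp_abs_im _).trans ?_
    rw [← Real.exp_add, Real.exp_le_exp, ← mul_add]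
    simp only [Complex.mul_im, Complex.ofReal_re, Complex.ofReal_im, zero_mul, add_zero,
      Complex.sub_im, abs_mul, abs_of_pos Real.pi_pos]
    exact mul_le_mul_of_nonneg_left (abs_sub _ _) Real.pi_pos.le
  rw [norm_mul, add_comm α z]
  calc _ ≤ ‖(Complex.Gamma (z + α))⁻¹‖ *
        (‖Complex.Gamma (1 - (β - z))‖ * ‖Complex.sin (Real.pi * (β - z))‖) := by
        gcongr
        exact norm_inv_Gamma_le h0
    _ = ‖Complex.Gamma (1 - (β - z)) * (Complex.Gamma (z + α))⁻¹‖ *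
        ‖Complex.sin (Real.pi * (β - z))‖ := by rw [norm_mul]; ring
    _ ≤ (C * (1 + |z.im|) ^ N * (1 + z.re) ^ ((1 - β).re - α.re)) *
        (Real.exp (Real.pi * |β.im|) * Real.exp (Real.pi * |z.im|)) := by
        have : 0 ≤ 1 + z.re := by linarith
        gcongr
    _ = _ := by
        rw [stripWeight, abs_of_nonneg hz,
          show (1 - β).re - α.re = -(α + β - 1).re by simp; ring]
        ring

theorem differentiable_inv_Gamma_mul (α β : ℂ) :
    Differentiable ℂ fun z => (Complex.Gamma (α + z))⁻¹ * (Complex.Gamma (β - z))⁻¹ :=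
  (Complex.differentiable_one_div_Gamma.comp (differentiable_id.const_add α)).mul
    (Complex.differentiable_one_div_Gamma.comp (differentiable_id.const_sub β))

/-- A disc is handled by compactness. Outside it, the left half plane reduces to the right one by z
↦ -z, which exchanges α and β. -/
theorem stripBound_inv_Gamma_mul (α β : ℂ) :
    StripBound (fun z => (Complex.Gamma (α + z))⁻¹ * (Complex.Gamma (β - z))⁻¹)
      Real.pi (α + β - 1).re := by
  obtain ⟨R₁, C₁, N₁, hC₁, h₁⟩ := exists_norm_inv_Gamma_mul_le_of_re_nonneg α β
  obtain ⟨R₂, C₂, N₂, hC₂, h₂⟩ := exists_norm_inv_Gamma_mul_le_of_re_nonneg β α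
  set F : ℂ → ℂ := fun z => (Complex.Gamma (α + z))⁻¹ * (Complex.Gamma (β - z))⁻¹ with hF
  set s := (α + β - 1).re with hs
  obtain ⟨C₀, hC₀⟩ := (isCompact_closedBall (0 : ℂ) (max R₁ R₂)).exists_bound_of_continuousOn
    (f := fun z => ‖F z‖ / stripWeight (N₁ + N₂) Real.pi s z)
    (((differentiable_inv_Gamma_mul α β).continuous.norm.div (continuous_stripWeight _ _ _)
      fun z => (stripWeight_pos _ _ _ z).ne').continuousOn)
  refine ⟨max C₀ (C₁ + C₂), N₁ + N₂, le_max_of_le_right (by positivity), fun z => ?_⟩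
  have hw := stripWeight_pos (N₁ + N₂) Real.pi s z
  have large : ∀ {C : ℝ} {N : ℕ}, 0 ≤ C → C ≤ C₁ + C₂ → N ≤ N₁ + N₂ →
      ‖F z‖ ≤ C * stripWeight N Real.pi s z →
      ‖F z‖ ≤ max C₀ (C₁ + C₂) * stripWeight (N₁ + N₂) Real.pi s z := by
    intro C N hC hCC hN h
    refine h.trans ?_
    have := stripWeight_mono hN Real.pi s z
    have := (stripWeight_pos N Real.pi s z).le
    have hm : C ≤ max C₀ (C₁ + C₂) := le_max_of_le_right hCC
    have hm0 : 0 ≤ max C₀ (C₁ + C₂) := hC.trans hm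
    gcongr
  rcases le_total ‖z‖ (max R₁ R₂) with hz | hz
  · have h := (le_abs_self _).trans (hC₀ z (by simpa using hz))
    exact ((div_le_iff₀ hw).1 h).trans (mul_le_mul_of_nonneg_right (le_max_left _ _) hw.le)
  rcases le_total 0 z.re with hre | hre
  · exact large hC₁ (by linarith) (Nat.le_add_right N₁ N₂) (h₁ z hre ((le_max_left _ _).trans hz))
  · refine large hC₂ (by linarith) (Nat.le_add_left N₂ N₁) ?_
    have h := h₂ (-z) (by simpa using hre) (by simpa using (le_max_right _ _).trans hz)
    rw [stripWeight_neg, sub_neg_eq_add, ← sub_eq_add_neg, mul_comm, add_comm β α] at h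
    exact h

/-! ### Vanishing of the Fourier transform beyond the type -/

theorem StripBound.exists_norm_le_of_real {F : ℂ → ℂ} {A s : ℝ} (h : StripBound F A s) :
    ∃ C : ℝ, 0 ≤ C ∧ ∀ x : ℝ, ‖F x‖ ≤ C * (1 + |x|) ^ (-s) := by
  obtain ⟨C, N, hC, h⟩ := h
  exact ⟨C, hC, fun x => by simpa [stripWeight] using h x⟩

theorem StripBound.integrable {F : ℂ → ℂ} {A s : ℝ} (h : StripBound F A s) (hs : 1 < s)
    (hF : Continuous F) : Integrable fun x : ℝ => F x := by
  obtain ⟨C, -, h⟩ := h.exists_norm_le_of_real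
  have h1 : Integrable fun x : ℝ => (1 + ‖x‖) ^ (-s) :=
    integrable_one_add_norm (by simpa using hs)
  exact (h1.const_mul C).mono' (hF.comp Complex.continuous_ofReal).aestronglyMeasurable
    (Eventually.of_forall h)

/-- The integral along the real line of an entire function with exponential decay in the upper
half plane and integrable horizontal decay vanishes. -/
theorem integral_eq_zero_of_upperHalfPlane_decay {H : ℂ → ℂ} (hH : Differentiable ℂ H)
    {C ε s : ℝ} (hC : 0 ≤ C) (hε : 0 < ε) (hs : 1 < s) (hint : Integrable fun x : ℝ => H x)
    (hb : ∀ z : ℂ, 0 ≤ z.im → ‖H z‖ ≤ C * Real.exp (-ε * z.im) * (1 + |z.re|) ^ (-s)) :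
    ∫ x : ℝ, H x = 0 := by
  have hlim : Tendsto (fun T : ℝ => ∫ x in (-T)..T, H x) atTop (𝓝 (∫ x : ℝ, H x)) :=
    intervalIntegral_tendsto_integral hint tendsto_neg_atTop_atBot tendsto_id
  refine tendsto_nhds_unique hlim ?_
  -- Cauchy's theorem on the rectangle [-T, T] × [0, T]: the first term bounds the top edge, the
  -- second the two vertical edges.
  have bound : ∀ T : ℝ, 0 ≤ T → ‖∫ x in (-T)..T, H x‖
      ≤ 2 * C * (T ^ (1 : ℝ) * Real.exp (-ε * T)) + 2 * C * (1 + T) ^ (-(s - 1)) := by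
    intro T hT
    have hrect := Complex.integral_boundary_rect_eq_zero_of_differentiableOn H
      ((-T : ℝ) : ℂ) (T + T * Complex.I) hH.differentiableOn
    simp only [Complex.ofReal_re, Complex.ofReal_im, Complex.add_re, Complex.add_im,
      Complex.mul_re, Complex.mul_im, Complex.I_re, Complex.I_im, mul_zero, mul_one, sub_zero,
      zero_add, add_zero, Complex.ofReal_zero, zero_mul, smul_eq_mul] at hrect
    have htop : ‖∫ x : ℝ in (-T)..T, H (x + T * Complex.I)‖
        ≤ C * Real.exp (-ε * T) * |T - -T| := by
      refine intervalIntegral.norm_integral_le_of_norm_le_const fun x _ => ?_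
      refine (hb _ (by simpa using hT)).trans ?_
      have : (1 + |((x : ℂ) + T * Complex.I).re|) ^ (-s) ≤ 1 :=
        Real.rpow_le_one_of_one_le_of_nonpos (by linarith [abs_nonneg ((x : ℂ) + T * Complex.I).re])
          (by linarith)
      simpa using mul_le_mul_of_nonneg_left this
        (mul_nonneg hC (Real.exp_pos (-ε * ((x : ℂ) + T * Complex.I).im)).le)
    have hside : ∀ u : ℝ, |u| = T → ‖∫ y : ℝ in (0 : ℝ)..T, H (u + y * Complex.I)‖
        ≤ C * (1 + T) ^ (-s) * |T - 0| := by
      intro u hu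
      refine intervalIntegral.norm_integral_le_of_norm_le_const fun y hy => ?_
      rw [Set.uIoc_of_le hT] at hy
      refine (hb _ (by simpa using hy.1.le)).trans ?_
      have h1 : Real.exp (-ε * y) ≤ 1 := Real.exp_le_one_iff.2 (by nlinarith [hy.1])
      have h2 : 0 ≤ (1 + T) ^ (-s) := by positivity
      simp only [Complex.add_im, Complex.ofReal_im, Complex.mul_im, Complex.ofReal_re,
        Complex.I_im, mul_one, Complex.I_re, mul_zero, add_zero, zero_add, Complex.add_re,
        Complex.mul_re, sub_zero, hu]
      nlinarith [mul_nonneg hC h2]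
    have hr := hside T (abs_of_nonneg hT)
    have hl := hside (-T) (by rw [abs_neg, abs_of_nonneg hT])
    have e : ∫ x in (-T)..T, H x = (∫ x : ℝ in (-T)..T, H (x + T * Complex.I))
        - Complex.I * (∫ y : ℝ in (0 : ℝ)..T, H (T + y * Complex.I))
        + Complex.I * (∫ y : ℝ in (0 : ℝ)..T, H ((-T : ℝ) + y * Complex.I)) := by
      linear_combination hrect
    have h1T : (1 + T) ^ (-s) * T ≤ (1 + T) ^ (-(s - 1)) := by
      rw [show -(s - 1) = -s + 1 by ring, Real.rpow_add_one (by positivity)]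
      exact mul_le_mul_of_nonneg_left (by linarith) (by positivity)
    rw [e]
    refine (norm_add_le _ _).trans ((add_le_add_left (norm_sub_le _ _) _).trans ?_)
    rw [norm_mul, norm_mul, Complex.norm_I, one_mul, one_mul, Real.rpow_one]
    rw [sub_zero, abs_of_nonneg hT] at hr hl
    rw [sub_neg_eq_add, abs_of_nonneg (by linarith)] at htop
    nlinarith [mul_le_mul_of_nonneg_left h1T hC]
  refine squeeze_zero_norm' ((eventually_ge_atTop 0).mono bound) ?_
  have t1 := tendsto_rpow_mul_exp_neg_mul_atTop_nhds_zero 1 ε hε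
  have t2 := (tendsto_rpow_neg_atTop (sub_pos.2 hs)).comp (tendsto_atTop_add_const_left atTop 1
    tendsto_id)
  simpa using (t1.const_mul (2 * C)).add (t2.const_mul (2 * C))

theorem StripBound.integral_exp_eq_zero_of_lt {F : ℂ → ℂ} {A s ω : ℝ} (h : StripBound F A s)
    (hs : 1 < s) (hF : Differentiable ℂ F) (hω : A < ω) :
    ∫ x : ℝ, F x * Complex.exp (Complex.I * ω * x) = 0 := by
  have hb := h
  obtain ⟨C, N, hC, hb⟩ := hb
  -- Half of the gap ω - A absorbs the polynomial in Im z; the other half remains as decay.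
  set ε := (ω - A) / 2 with hε
  have hε0 : 0 < ε := by rw [hε]; linarith
  refine integral_eq_zero_of_upperHalfPlane_decay (H := fun z => F z * Complex.exp (Complex.I * ω * z))
    (C := C * (N.factorial / ε ^ N * Real.exp ε)) (ε := ε) (s := s)
    (by fun_prop) (by positivity) hε0 hs ?_ fun z hz => ?_
  · refine (h.integrable hs hF.continuous).mul_bdd (c := 1) (by fun_prop)
      (Eventually.of_forall fun x => ?_)
    simp [Complex.norm_exp]
  · have h1 := Real.pow_div_factorial_le_exp (x := ε * (1 + z.im)) (by positivity) N
    have h2 : (1 + z.im) ^ N ≤ N.factorial / ε ^ N * Real.exp ε * Real.exp (ε * z.im) := by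
      rw [mul_pow, div_le_iff₀ (by positivity), mul_add, mul_one, Real.exp_add] at h1
      rw [div_mul_eq_mul_div, div_mul_eq_mul_div, le_div_iff₀ (by positivity)]
      linarith
    have h3 : ‖Complex.exp (Complex.I * ω * z)‖ = Real.exp (-ω * z.im) := by
      rw [Complex.norm_exp]
      simp
    rw [norm_mul, h3]
    calc _ ≤ (C * stripWeight N A s z) * Real.exp (-ω * z.im) := by gcongr; exact hb z
      _ = C * (1 + z.im) ^ N * (Real.exp (A * z.im) * Real.exp (-ω * z.im)) *
          (1 + |z.re|) ^ (-s) := by rw [stripWeight, abs_of_nonneg hz]; ring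
      _ ≤ C * (N.factorial / ε ^ N * Real.exp ε * Real.exp (ε * z.im)) *
          (Real.exp (A * z.im) * Real.exp (-ω * z.im)) * (1 + |z.re|) ^ (-s) := by gcongr
      _ = C * (N.factorial / ε ^ N * Real.exp ε) *
          (Real.exp (ε * z.im) * (Real.exp (A * z.im) * Real.exp (-ω * z.im))) *
            (1 + |z.re|) ^ (-s) := by ring
      _ = _ := by
          rw [← Real.exp_add, ← Real.exp_add]
          congr 3
          rw [hε]
          ring

theorem continuous_integral_mul_exp {g : ℝ → ℂ} (hg : Integrable g) :
    Continuous fun ω : ℝ => ∫ x : ℝ, g x * Complex.exp (Complex.I * ω * x) := by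
  refine continuous_of_dominated (bound := fun x => ‖g x‖) (fun ω => ?_) (fun ω => ?_) hg.norm
    (Eventually.of_forall fun x => by fun_prop)
  · exact hg.aestronglyMeasurable.mul (by fun_prop)
  · exact Eventually.of_forall fun x => by simp [Complex.norm_exp]

/-- The Fourier transform of an integrable entire function of exponential type `A` is supported in
`(-A, A)`. -/
theorem StripBound.integral_exp_eq_zero {F : ℂ → ℂ} {A s ω : ℝ} (h : StripBound F A s)
    (hs : 1 < s) (hF : Differentiable ℂ F) (hω : A ≤ |ω|) :
    ∫ x : ℝ, F x * Complex.exp (Complex.I * ω * x) = 0 := by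
  have key : ∀ {G : ℂ → ℂ}, StripBound G A s → Differentiable ℂ G → ∀ ω : ℝ, A ≤ ω →
      ∫ x : ℝ, G x * Complex.exp (Complex.I * ω * x) = 0 := by
    intro G h hG ω hω
    -- The transform is continuous in ω, so the vanishing extends to ω = A. This endpoint occurs
    -- when m = p + 1.
    have hc : IsClosed {ω : ℝ | ∫ x : ℝ, G x * Complex.exp (Complex.I * ω * x) = 0} :=
      isClosed_eq (continuous_integral_mul_exp (h.integrable hs hG.continuous)) continuous_const
    have hsub : Set.Ioi A ⊆ {ω : ℝ | ∫ x : ℝ, G x * Complex.exp (Complex.I * ω * x) = 0} :=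
      fun ω hω => h.integral_exp_eq_zero_of_lt hs hG hω
    have := closure_minimal hsub hc
    rw [closure_Ioi] at this
    exact this hω
  rcases le_abs.1 hω with hω | hω
  · exact key h hF ω hω
  · have := key h.comp_neg (hF.comp differentiable_neg) (-ω) hω
    rw [← integral_neg_eq_self] at this
    simpa using this

/-! ### The sine kernel and Poisson summation -/

theorem sum_exp_mul_sin (p : ℕ) (x : ℝ) :
    (∑ k ∈ Finset.range p,
        Complex.exp (Complex.I * ((Real.pi * (p - 1) - 2 * Real.pi * k : ℝ) : ℂ) * x)) *
      Complex.sin (Real.pi * x) = Complex.sin (p * Real.pi * x) := by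
  -- Multiplying an exponential by sin(πx) shifts its frequency by ±π, so the sum telescopes along
  -- `u`.
  set u : ℕ → ℂ := fun k =>
    Complex.exp (Complex.I * ((Real.pi * (p - 2 * k) : ℝ) : ℂ) * x) * Complex.I / 2 with hu
  have h : ∀ k : ℕ, Complex.exp (Complex.I * ((Real.pi * (p - 1) - 2 * Real.pi * k : ℝ) : ℂ) * x) *
      Complex.sin (Real.pi * x) = u (k + 1) - u k := by
    intro k
    simp only [hu, Complex.sin]
    rw [← sub_div, ← sub_mul, mul_div_assoc', ← mul_assoc, mul_sub, ← Complex.exp_add,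
      ← Complex.exp_add]
    congr 4 <;> · push_cast; ring
  rw [Finset.sum_mul, Finset.sum_congr rfl fun k _ => h k, Finset.sum_range_sub]
  simp only [hu, Complex.sin]
  rw [← sub_div, ← sub_mul]
  congr 4 <;> · push_cast; ring

/-- Only almost everywhere: at integers the quotient is 0/0 = 0 by convention. -/
theorem sum_exp_ae_eq_sin_div_sin (p : ℕ) :
    ∀ᵐ x : ℝ, (∑ k ∈ Finset.range p,
        Complex.exp (Complex.I * ((Real.pi * (p - 1) - 2 * Real.pi * k : ℝ) : ℂ) * x))
      = ((Real.sin ((p : ℝ) * Real.pi * x) / Real.sin (Real.pi * x) : ℝ) : ℂ) := by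
  have hz : ∀ᵐ x : ℝ, Real.sin (Real.pi * x) ≠ 0 := by
    have hcount : (Set.range fun n : ℤ => (n : ℝ)).Countable := Set.countable_range _
    refine measure_mono_null (fun x hx => ?_) (hcount.measure_zero volume)
    simp only [ne_eq, Set.mem_compl_iff, Set.mem_ofPred_eq, not_not] at hx
    obtain ⟨n, hn⟩ := Real.sin_eq_zero_iff.1 hx
    refine ⟨n, mul_right_cancel₀ Real.pi_ne_zero ?_⟩
    rw [mul_comm x]
    exact hn
  filter_upwards [hz] with x hx
  have hx' : Complex.sin (Real.pi * x) ≠ 0 := by exact_mod_cast hx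
  push_cast
  rw [eq_div_iff hx']
  have := sum_exp_mul_sin p x
  push_cast at this
  exact this

theorem StripBound.integrable_mul_exp {F : ℂ → ℂ} {A s : ℝ} (h : StripBound F A s) (hs : 1 < s)
    (hF : Continuous F) (ω : ℝ) :
    Integrable fun x : ℝ => F x * Complex.exp (Complex.I * ω * x) := by
  refine (h.integrable hs hF).mul_bdd (c := 1) (by fun_prop) (Eventually.of_forall fun x => ?_)
  simp [Complex.norm_exp]

theorem StripBound.integrable_mul_sin_div_sin {F : ℂ → ℂ} {A s : ℝ} (h : StripBound F A s)
    (hs : 1 < s) (hF : Continuous F) (p : ℕ) :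
    Integrable fun x : ℝ => F x *
      ((Real.sin ((p : ℝ) * Real.pi * x) / Real.sin (Real.pi * x) : ℝ) : ℂ) := by
  refine (integrable_finsetSum (Finset.range p) fun k _ =>
    h.integrable_mul_exp hs hF (Real.pi * (p - 1) - 2 * Real.pi * k)).congr ?_
  filter_upwards [sum_exp_ae_eq_sin_div_sin p] with x hx
  rw [← hx, Finset.mul_sum]

/-- Poisson summation for an entire function of exponential type at most `(p + 1) π`. -/
theorem StripBound.integral_mul_sin_div_sin {F : ℂ → ℂ} {m p : ℕ} {s : ℝ}
    (h : StripBound F (m * Real.pi) s) (hs : 1 < s) (hF : Differentiable ℂ F) (hmp : m ≤ p + 1) :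
    ∫ x : ℝ, F x * ((Real.sin ((p : ℝ) * Real.pi * x) / Real.sin (Real.pi * x) : ℝ) : ℂ)
      = ∑' n : ℤ, F n * Complex.exp (Complex.I * (Real.pi * (p - 1)) * n) := by
  -- The top frequency of the kernel: its p frequencies are then θ - 2πn for 0 ≤ n < p.
  set θ : ℝ := Real.pi * (p - 1) with hθ
  set g : ℝ → ℂ := fun x => F x * Complex.exp (Complex.I * θ * x) with hg
  have hfour : ∀ n : ℤ, FourierTransform.fourier g (n : ℝ)
      = ∫ x : ℝ, F x * Complex.exp (Complex.I * ((θ - 2 * Real.pi * n : ℝ) : ℂ) * x) := by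
    intro n
    rw [Real.fourier_real_eq_integral_exp_smul]
    congr 1
    ext x
    rw [hg, smul_eq_mul, mul_left_comm, ← Complex.exp_add]
    congr 2
    push_cast
    ring
  -- The nearest excluded indices, n = -1 and n = p, give frequencies ±(p+1)π, already of modulus at
  -- least mπ.
  have hzero : ∀ n : ℤ, n ∉ (Finset.range p).map Nat.castEmbedding →
      FourierTransform.fourier g (n : ℝ) = 0 := by
    intro n hn
    rw [hfour]
    refine h.integral_exp_eq_zero hs hF ?_
    have hn' : n < 0 ∨ (p : ℤ) ≤ n := by
      by_contra! hcon
      obtain ⟨k, rfl⟩ := Int.eq_ofNat_of_zero_le hcon.1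
      exact hn (Finset.mem_map.2 ⟨k, Finset.mem_range.2 (by exact_mod_cast hcon.2), rfl⟩)
    have hmp' : (m : ℝ) ≤ p + 1 := by exact_mod_cast hmp
    rw [hθ, show Real.pi * ((p : ℝ) - 1) - 2 * Real.pi * n = (p - 1 - 2 * n) * Real.pi by ring,
      abs_mul, abs_of_pos Real.pi_pos]
    refine mul_le_mul_of_nonneg_right ?_ Real.pi_pos.le
    rcases hn' with hn' | hn'
    · have : (n : ℝ) ≤ -1 := by exact_mod_cast (by omega : n ≤ -1)
      exact le_abs.2 (Or.inl (by linarith))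
    · have : (p : ℝ) ≤ n := by exact_mod_cast hn'
      exact le_abs.2 (Or.inr (by linarith))
  have hcont : Continuous g := by
    have := hF.continuous
    fun_prop
  have hO : g =O[cocompact ℝ] fun x : ℝ => |x| ^ (-s) := by
    obtain ⟨C, hC, hb⟩ := h.exists_norm_le_of_real
    refine Asymptotics.IsBigO.of_bound C ?_
    filter_upwards [isCompact_singleton (x := (0 : ℝ)).compl_mem_cocompact] with x hx
    have hx0 : 0 < |x| := abs_pos.2 hx
    have h1 : ‖g x‖ = ‖F x‖ := by simp [hg, Complex.norm_exp]
    rw [h1, Real.norm_of_nonneg (by positivity)]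
    refine (hb x).trans (mul_le_mul_of_nonneg_left ?_ hC)
    exact Real.rpow_le_rpow_of_nonpos hx0 (by linarith) (by linarith)
  have hpois := Real.tsum_eq_tsum_fourier_of_rpow_decay_of_summable hcont hs hO
    (summable_of_ne_finset_zero hzero) 0
  simp only [zero_add, QuotientAddGroup.mk_zero, fourier_eval_zero, mul_one] at hpois
  have hsum : ∑' n : ℤ, F n * Complex.exp (Complex.I * (Real.pi * (p - 1)) * n)
      = ∑' n : ℤ, g n := by
    congr 1
    ext n
    simp [hg, hθ]
  rw [hsum, hpois, tsum_eq_sum hzero, Finset.sum_map]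
  have e : ∀ k : ℕ, FourierTransform.fourier g (((Nat.castEmbedding k : ℤ) : ℝ))
      = ∫ x : ℝ, F x * Complex.exp (Complex.I * ((θ - 2 * Real.pi * k : ℝ) : ℂ) * x) := by
    intro k
    rw [hfour]
    simp
  rw [Finset.sum_congr rfl fun k _ => e k,
    ← integral_finsetSum _ fun k _ => h.integrable_mul_exp hs hF.continuous _]
  refine integral_congr_ae ?_
  filter_upwards [sum_exp_ae_eq_sin_div_sin p] with x hx
  rw [← hx, Finset.mul_sum]

/-! ### Shifted factorials and convergence of the series -/

theorem inv_Gamma_eq_ascPochhammer_mul (s : ℂ) (k : ℕ) :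
    (Complex.Gamma s)⁻¹ = (ascPochhammer ℂ k).eval s * (Complex.Gamma (s + k))⁻¹ := by
  induction k with
  | zero => simp
  | succ k ih =>
    rw [ih, Complex.one_div_Gamma_eq_self_mul_one_div_Gamma_add_one (s + k),
      ascPochhammer_succ_eval]
    push_cast
    ring_nf

theorem inv_shiftedFactorial_mul_inv_Gamma {d : ℂ} (hd : Complex.Gamma d ≠ 0) (n : ℤ) :
    (shiftedFactorial d n)⁻¹ * (Complex.Gamma d)⁻¹ = (Complex.Gamma (d + n))⁻¹ := by
  cases n with
  | ofNat n =>
    have h := inv_Gamma_eq_ascPochhammer_mul d n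
    have h0 : (ascPochhammer ℂ n).eval d ≠ 0 := fun h1 => by
      rw [h1, zero_mul] at h
      exact hd (inv_eq_zero.1 h)
    simp only [shiftedFactorial, Int.ofNat_eq_natCast, Int.cast_natCast]
    rw [h, inv_mul_cancel_left₀ h0]
  | negSucc n =>
    have h := inv_Gamma_eq_ascPochhammer_mul (d - ((n : ℂ) + 1)) (n + 1)
    simp only [shiftedFactorial, inv_inv, Int.cast_negSucc]
    push_cast at h ⊢
    rw [sub_add_cancel] at h
    rw [← h, ← sub_eq_add_neg]

/-- Reversing the order and signs of the factors. With 0⁻¹ = 0 it needs no hypothesis on c. -/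
theorem shiftedFactorial_eq_inv_one_sub (c : ℂ) (n : ℤ) :
    shiftedFactorial c n = (-1) ^ n * (shiftedFactorial (1 - c) (-n))⁻¹ := by
  have key : ∀ (c : ℂ) (k : ℕ), (ascPochhammer ℂ k).eval c
      = (-1) ^ k * (ascPochhammer ℂ k).eval (1 - c - k) := by
    intro c k
    have h := ascPochhammer_eval_neg_eq_descPochhammer ℂ (-c) k
    rw [neg_neg, descPochhammer_eval_eq_ascPochhammer] at h
    rw [h]
    congr 2
    ring
  rcases n with (_ | k) | k
  · simp [shiftedFactorial]
  · have h := key c (k + 1)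
    change (ascPochhammer ℂ (k + 1)).eval c = (-1) ^ ((k + 1 : ℕ) : ℤ) *
      ((ascPochhammer ℂ (k + 1)).eval (1 - c - ((k : ℂ) + 1)))⁻¹⁻¹
    rw [inv_inv, zpow_natCast, h]
    push_cast
    rfl
  · have h := key (1 - c) (k + 1)
    change ((ascPochhammer ℂ (k + 1)).eval (c - ((k : ℂ) + 1)))⁻¹ = (-1) ^ (-((k + 1 : ℕ) : ℤ)) *
      ((ascPochhammer ℂ (k + 1)).eval (1 - c))⁻¹
    rw [h, mul_inv, zpow_neg, zpow_natCast, ← mul_assoc, ← mul_inv, ← mul_pow]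
    push_cast
    simp

theorem norm_shiftedFactorial_neg (c : ℂ) (n : ℤ) :
    ‖shiftedFactorial c (-n)‖ = ‖shiftedFactorial (1 - c) n‖⁻¹ := by
  rw [shiftedFactorial_eq_inv_one_sub c, neg_neg]
  simp

theorem shiftedFactorial_neg_mul_inv_Gamma {b : ℂ} (hb : Complex.Gamma (b + 1) ≠ 0) (n : ℤ) :
    shiftedFactorial (-b) n * (Complex.Gamma (b + 1))⁻¹
      = (-1) ^ n * (Complex.Gamma (b + 1 - n))⁻¹ := by
  have h := inv_shiftedFactorial_mul_inv_Gamma hb (-n)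
  rw [shiftedFactorial_eq_inv_one_sub, show 1 - -b = b + 1 by ring, mul_assoc, h]
  push_cast
  rfl

theorem shiftedFactorial_neg_natCast_of_lt {l n : ℕ} (h : l < n) :
    shiftedFactorial (-(l : ℂ)) n = 0 :=
  ascPochhammer_eval_neg_coe_nat_of_lt h

theorem shiftedFactorial_div_isBigO (c d : ℂ) :
    (fun n : ℕ => shiftedFactorial c n / shiftedFactorial d n)
      =O[atTop] fun n : ℕ => (1 + (n : ℝ)) ^ (c.re - d.re) := by
  -- If c or d is a pole of Γ, the quotient is eventually 0: through its numerator for c, through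
  -- division by zero for d.
  by_cases hc : Complex.Gamma c = 0
  · obtain ⟨l, rfl⟩ := (Complex.Gamma_eq_zero_iff c).1 hc
    refine Asymptotics.IsBigO.of_bound 0 ?_
    filter_upwards [eventually_gt_atTop l] with n hn
    simp [shiftedFactorial_neg_natCast_of_lt hn]
  by_cases hd : Complex.Gamma d = 0
  · obtain ⟨l, rfl⟩ := (Complex.Gamma_eq_zero_iff d).1 hd
    refine Asymptotics.IsBigO.of_bound 0 ?_
    filter_upwards [eventually_gt_atTop l] with n hn
    simp [shiftedFactorial_neg_natCast_of_lt hn]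
  obtain ⟨R, C, N, -, h⟩ := gammaRatioBound c d
  refine Asymptotics.IsBigO.of_bound (C * ‖(Complex.Gamma c)⁻¹ * Complex.Gamma d‖) ?_
  filter_upwards [eventually_ge_atTop ⌈R⌉₊] with n hn
  have hn' : R ≤ ‖(n : ℂ)‖ := by simpa using Nat.ceil_le.1 hn
  obtain ⟨-, h1⟩ := h n (by simp) hn'
  have ec := inv_shiftedFactorial_mul_inv_Gamma hc n
  have ed := inv_shiftedFactorial_mul_inv_Gamma hd n
  rw [Int.cast_natCast, add_comm] at ec ed
  have ec' : shiftedFactorial c n = (Complex.Gamma c)⁻¹ * Complex.Gamma (n + c) := by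
    rw [← mul_inv, inv_inj] at ec
    rw [← ec, mul_left_comm, inv_mul_cancel₀ hc, mul_one]
  have ed' : (shiftedFactorial d n)⁻¹ = Complex.Gamma d * (Complex.Gamma (n + d))⁻¹ := by
    rw [← ed, mul_left_comm, mul_inv_cancel₀ hd, mul_one]
  rw [div_eq_mul_inv, ec', ed', mul_mul_mul_comm, norm_mul, Real.norm_of_nonneg (by positivity),
    mul_comm C, mul_assoc]
  refine mul_le_mul_of_nonneg_left ?_ (norm_nonneg _)
  simpa using h1

theorem summable_prod_shiftedFactorial_div {m : ℕ} (c d : Fin m → ℂ)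
    (h : 1 < ∑ j, (d j - c j).re) :
    Summable fun n : ℕ =>
      ‖(∏ j, shiftedFactorial (c j) n) / ∏ j, shiftedFactorial (d j) n‖ := by
  have hO : (fun n : ℕ => (∏ j, shiftedFactorial (c j) n) / ∏ j, shiftedFactorial (d j) n)
      =O[atTop] fun n : ℕ => (1 + (n : ℝ)) ^ (-∑ j, (d j - c j).re) := by
    have h1 := Asymptotics.IsBigO.finsetProd (s := Finset.univ) (l := atTop)
      fun j _ => shiftedFactorial_div_isBigO (c j) (d j)
    refine (h1.congr (fun n => ?_) fun n => ?_)
    · rw [Finset.prod_div_distrib]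
    · rw [← Real.rpow_sum_of_pos (by positivity), ← Finset.sum_neg_distrib]
      simp
  refine (summable_of_isBigO_nat ?_ hO).norm
  have hs := (summable_nat_add_iff 1).2
    (Real.summable_nat_rpow (p := -∑ j, (d j - c j).re).2 (by linarith))
  refine hs.congr fun n => ?_
  push_cast
  rw [add_comm]

/-- Reflection turns the negative half into a forward series with parameters 1 - d over 1 - c. The
differences d_j - c_j, hence the decay exponent, are unchanged. -/
theorem summable_bilateralTerm {m : ℕ} (c d : Fin m → ℂ) {z : ℂ} (hz : ‖z‖ = 1)
    (h : 1 < ∑ j, (d j - c j).re) : Summable (bilateralTerm c d z) := by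
  refine Summable.of_norm (Summable.of_nat_of_neg ?_ ?_)
  · refine (summable_prod_shiftedFactorial_div c d h).congr fun n => ?_
    simp [bilateralTerm, hz]
  · refine (summable_prod_shiftedFactorial_div (fun j => 1 - d j) (fun j => 1 - c j)
      (by simpa using h)).congr fun n => ?_
    simp only [bilateralTerm, norm_mul, norm_div, norm_zpow, hz, one_zpow, mul_one, norm_prod,
      norm_shiftedFactorial_neg, Finset.prod_inv_distrib]
    rw [div_inv_eq_mul, mul_comm, ← div_eq_mul_inv]

/-! ### Series terms as values of `f` at the integers -/

theorem gammaConst_mul_bilateralTerm {m : ℕ} {a b : Fin m → ℂ} (h : gammaConst a b ≠ 0) (z : ℂ)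
    (n : ℤ) : gammaConst a b * bilateralTerm (fun j => -b j) (fun j => a j + 1) z n
      = gammaProduct a b n * (z ^ n * ((-1) ^ n) ^ m) := by
  have h0 : ∀ j, Complex.Gamma (a j + 1) * Complex.Gamma (b j + 1) ≠ 0 := by
    intro j hj
    exact h (by rw [gammaConst, Finset.prod_eq_zero (Finset.mem_univ j) hj, div_zero])
  have e : ∀ j, (Complex.Gamma (a j + 1) * Complex.Gamma (b j + 1))⁻¹ *
      (shiftedFactorial (-b j) n / shiftedFactorial (a j + 1) n)
      = 1 / (Complex.Gamma (a j + 1 + ((n : ℝ) : ℂ)) * Complex.Gamma (b j + 1 - ((n : ℝ) : ℂ))) *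
        (-1) ^ n := by
    intro j
    have h1 := inv_shiftedFactorial_mul_inv_Gamma (left_ne_zero_of_mul (h0 j)) n
    have h2 := shiftedFactorial_neg_mul_inv_Gamma (right_ne_zero_of_mul (h0 j)) n
    rw [Complex.ofReal_intCast, one_div, mul_inv, mul_inv, ← h1, div_eq_mul_inv]
    linear_combination (shiftedFactorial (a j + 1) n)⁻¹ * (Complex.Gamma (a j + 1))⁻¹ * h2
  have e' := Finset.prod_congr (rfl : (Finset.univ : Finset (Fin m)) = _) fun j _ => e j
  simp only [one_div, Finset.prod_mul_distrib, Finset.prod_div_distrib, Finset.prod_inv_distrib,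
    Finset.prod_const, Finset.card_univ, Fintype.card_fin] at e'
  simp only [gammaConst, bilateralTerm, gammaProduct, Finset.prod_mul_distrib,
    Finset.prod_inv_distrib, one_div]
  rw [← mul_assoc, e']
  ring

theorem Complex.Gamma_intCast_eq_zero {i : ℤ} (hi : i ≤ 0) : Complex.Gamma i = 0 := by
  refine (Complex.Gamma_eq_zero_iff _).2 ⟨(-i).toNat, ?_⟩
  have : (((-i).toNat : ℤ) : ℂ) = ((-i : ℤ) : ℂ) := by rw [Int.toNat_of_nonneg (by omega)]
  rw [Int.cast_natCast] at this
  rw [this]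
  simp

/-- If a_j + 1 = -k, the factor 1/Γ(a_j+1+n) vanishes for n ≤ k. Well-definedness supplies b_i = l ≤
k, and 1/Γ(b_i+1-n) vanishes for n > l, so every integer is covered. A pole at b_j + 1 is symmetric.
-/
theorem gammaProduct_intCast_eq_zero {m : ℕ} {a b : Fin m → ℂ}
    (hwd : BilateralWellDefined (fun j => -b j) (fun j => a j + 1)) (h : gammaConst a b = 0)
    (n : ℤ) : gammaProduct a b n = 0 := by
  have left : ∀ {j : Fin m} {i : ℤ}, a j + 1 + n = i → i ≤ 0 → gammaProduct a b n = 0 := by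
    intro j i hj hi
    refine Finset.prod_eq_zero (Finset.mem_univ j) ?_
    rw [Complex.ofReal_intCast, hj, Complex.Gamma_intCast_eq_zero hi, zero_mul, div_zero]
  have right : ∀ {j : Fin m} {i : ℤ}, b j + 1 - n = i → i ≤ 0 → gammaProduct a b n = 0 := by
    intro j i hj hi
    refine Finset.prod_eq_zero (Finset.mem_univ j) ?_
    rw [Complex.ofReal_intCast, hj, Complex.Gamma_intCast_eq_zero hi, mul_zero, div_zero]
  have h' : ∏ j, (Complex.Gamma (a j + 1) * Complex.Gamma (b j + 1)) = 0 := by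
    simpa [gammaConst] using h
  obtain ⟨j, -, hj⟩ := Finset.prod_eq_zero_iff.1 h'
  rcases mul_eq_zero.1 hj with hj | hj
  · obtain ⟨k, hk⟩ := (Complex.Gamma_eq_zero_iff _).1 hj
    obtain ⟨i, l, hl, hi⟩ := hwd.1 j k hk
    rcases le_or_gt n k with hn | hn
    · exact left (j := j) (i := n - k) (by push_cast; rw [hk]; ring) (by omega)
    · exact right (j := i) (i := l + 1 - n) (by push_cast; linear_combination -hi) (by omega)
  · obtain ⟨k, hk⟩ := (Complex.Gamma_eq_zero_iff _).1 hj
    obtain ⟨i, l, hl, hi⟩ := hwd.2 j k (by linear_combination -hk)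
    rcases le_or_gt (-(k : ℤ)) n with hn | hn
    · exact right (j := j) (i := -k - n) (by push_cast; rw [hk]) (by omega)
    · exact left (j := i) (i := l + 1 + n) (by push_cast; linear_combination hi) (by omega)

theorem gammaConst_mul_bilateralH {m : ℕ} {a b : Fin m → ℂ}
    (hwd : BilateralWellDefined (fun j => -b j) (fun j => a j + 1)) (z : ℂ) :
    gammaConst a b * bilateralH (fun j => -b j) (fun j => a j + 1) z
      = ∑' n : ℤ, gammaProduct a b n * (z ^ n * ((-1) ^ n) ^ m) := by
  by_cases h : gammaConst a b = 0
  · simp [h, gammaProduct_intCast_eq_zero hwd h]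
  · rw [bilateralH, ← tsum_mul_left]
    exact tsum_congr fun n => gammaConst_mul_bilateralTerm h z n

theorem exp_I_mul_pi_sub_one_mul_int (p : ℕ) (n : ℤ) :
    Complex.exp (Complex.I * (Real.pi * (p - 1)) * n) = ((-1) ^ n) ^ (p + 1) := by
  -- Passing from p - 1 to p + 1 changes the exponent by 2πin and leaves a natural power even for p
  -- = 0.
  have e : Complex.I * (Real.pi * (p - 1)) * n
      = (((p + 1) * n : ℤ) : ℂ) * (Real.pi * Complex.I) - n * (2 * Real.pi * Complex.I) := by
    push_cast
    ring
  rw [e, Complex.exp_sub, Complex.exp_int_mul, Complex.exp_pi_mul_I,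
    Complex.exp_int_mul_two_pi_mul_I, div_one, mul_comm, zpow_mul]
  exact_mod_cast rfl

/-- The entire extension of `gammaProduct`. -/
noncomputable def gammaProductEntire {m : ℕ} (a b : Fin m → ℂ) (z : ℂ) : ℂ :=
  ∏ j, (Complex.Gamma (a j + 1 + z))⁻¹ * (Complex.Gamma (b j + 1 - z))⁻¹

theorem gammaProductEntire_ofReal {m : ℕ} (a b : Fin m → ℂ) (x : ℝ) :
    gammaProductEntire a b x = gammaProduct a b x := by
  simp [gammaProductEntire, gammaProduct, mul_comm]

theorem differentiable_gammaProductEntire {m : ℕ} (a b : Fin m → ℂ) :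
    Differentiable ℂ (gammaProductEntire a b) :=
  Differentiable.fun_finsetProd fun j _ => differentiable_inv_Gamma_mul (a j + 1) (b j + 1)

theorem stripBound_gammaProductEntire {m : ℕ} (a b : Fin m → ℂ) :
    StripBound (gammaProductEntire a b) (m * Real.pi) (∑ j, (a j + b j + 1).re) := by
  have h := StripBound.prod Finset.univ fun j _ => stripBound_inv_Gamma_mul (a j + 1) (b j + 1)
  have e : ∑ j, (a j + 1 + (b j + 1) - 1).re = ∑ j, (a j + b j + 1).re :=
    Finset.sum_congr rfl fun j _ => by congr 1; ring
  rw [e, Finset.sum_const, Finset.card_univ, Fintype.card_fin, nsmul_eq_mul] at h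
  exact h

/-! ### The two integral formulas -/

/-- Common form of both formulas: `hzp` matches the sign of the series term with the sign produced
by Poisson summation. -/
theorem integral_gammaProduct_mul_sin_div_sin {m p : ℕ} {a b : Fin m → ℂ}
    (hwd : BilateralWellDefined (fun j => -b j) (fun j => a j + 1))
    (hab : 1 < ∑ j, (a j + b j + 1).re) (hmp : m ≤ p + 1) {z : ℂ} (hz : ‖z‖ = 1)
    (hzp : ∀ n : ℤ, z ^ n * ((-1) ^ n) ^ m = ((-1) ^ n) ^ (p + 1)) :
    Integrable (fun x : ℝ => gammaProduct a b x *
        ((Real.sin ((p : ℝ) * Real.pi * x) / Real.sin (Real.pi * x) : ℝ) : ℂ)) ∧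
      Summable (bilateralTerm (fun j => -b j) (fun j => a j + 1) z) ∧
      ∫ x : ℝ, gammaProduct a b x *
          ((Real.sin ((p : ℝ) * Real.pi * x) / Real.sin (Real.pi * x) : ℝ) : ℂ)
        = gammaConst a b * bilateralH (fun j => -b j) (fun j => a j + 1) z := by
  have hB := stripBound_gammaProductEntire a b
  have hD := differentiable_gammaProductEntire a b
  refine ⟨?_, summable_bilateralTerm _ _ hz ?_, ?_⟩
  · simpa only [gammaProductEntire_ofReal] using
      hB.integrable_mul_sin_div_sin hab hD.continuous p
  · refine hab.trans_eq (Finset.sum_congr rfl fun j _ => ?_)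
    congr 1
    ring
  · rw [gammaConst_mul_bilateralH hwd]
    simp only [← gammaProductEntire_ofReal]
    rw [hB.integral_mul_sin_div_sin hab hD hmp]
    refine tsum_congr fun n => ?_
    rw [exp_I_mul_pi_sub_one_mul_int, hzp, Complex.ofReal_intCast]

theorem theorem4p4 (m : ℕ) (a b : Fin m → ℂ)
    (hwd : BilateralWellDefined (fun j => -b j) (fun j => a j + 1))
    (hab : 1 < ∑ j, (a j + b j + 1).re) :
    (Integrable (fun x : ℝ => gammaProduct a b x *
        ((Real.sin (((m : ℝ) - 1) * Real.pi * x) / Real.sin (Real.pi * x) : ℝ) : ℂ)) ∧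
      Summable (bilateralTerm (fun j => -b j) (fun j => a j + 1) 1) ∧
      ∫ x : ℝ, gammaProduct a b x *
          ((Real.sin (((m : ℝ) - 1) * Real.pi * x) / Real.sin (Real.pi * x) : ℝ) : ℂ)
        = gammaConst a b * bilateralH (fun j => -b j) (fun j => a j + 1) 1) ∧
    (Integrable (fun x : ℝ => gammaProduct a b x *
        ((Real.sin ((m : ℝ) * Real.pi * x) / Real.sin (Real.pi * x) : ℝ) : ℂ)) ∧
      Summable (bilateralTerm (fun j => -b j) (fun j => a j + 1) (-1)) ∧
      ∫ x : ℝ, gammaProduct a b x *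
          ((Real.sin ((m : ℝ) * Real.pi * x) / Real.sin (Real.pi * x) : ℝ) : ℂ)
        = gammaConst a b * bilateralH (fun j => -b j) (fun j => a j + 1) (-1)) := by
  -- For m = 0 the empty sum in `hab` is 0, so m ≥ 1 and m - 1 is the natural number q.
  obtain ⟨q, rfl⟩ : ∃ q, m = q + 1 := by
    refine Nat.exists_eq_succ_of_ne_zero ?_
    rintro rfl
    norm_num at hab
  refine ⟨?_, integral_gammaProduct_mul_sin_div_sin hwd hab (by omega) (by simp) fun n => ?_⟩
  · have h := integral_gammaProduct_mul_sin_div_sin (p := q) (z := 1) hwd hab le_rfl (by simp)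
      fun n => by rw [one_zpow, one_mul]
    simpa only [Nat.cast_add, Nat.cast_one, add_sub_cancel_right] using h
  · rw [pow_succ' _ (q + 1)]
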